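/- A *mass problem* is a subset of $\omega^\omega$; $\mathcal{A} \leq_{\mathcal{M}} \mathcal{B}$ (Medvedev reducibility) means that there is a Turing functional $\Phi$ with $\Phi(\mathcal{B}) \subseteq \mathcal{A}$. The equivalence classes of mass problems under mutual Medvedev reducibility form the Medvedev lattice $\mathcal{M}$, with join $\oplus$ and meet $\otimes$. A *Brouwer algebra* is a bounded distributive lattice with an operation $\to$ such that $a \oplus c \geq b$ if and only if $c \geq a \to b$. The lattice $\mathcal{M}$ is a Brouwer algebra under the operations induced by $\mathcal{A} \oplus \mathcal{B} = \{f \oplus g \mid f \in \mathcal{A},\, g \in \mathcal{B}\}$, $\mathcal{A} \otimes \mathcal{B} = \{0^\frown f \mid f \in \mathcal{A}\} \cup \{1^\frown g \mid g \in \mathcal{B}\}$ and $\mathcal{A} \to \mathcal{B} = \{e^\frown f \mid \forall g \in \mathcal{A}\ \Phi_e(f \oplus g) \in \mathcal{B}\}$. For elements $x \leq y$ of a Brouwer algebra, the interval $[x,y] = \{z \mid x \leq z \leq y\}$ is a Brouwer algebra under the implication $u \to_{[x,y]} v = (u \to v) \oplus x$. A *sub-Brouwer algebra* is a subset that contains $0$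 and $1$ and is closed under $\oplus$, $\otimes$ and $\to$. **Corollary.** Let $n \in \omega$ and let $I$ be a set of size $n$. Let $\mathcal{A} \subseteq \omega^\omega$ be downwards closed under Turing reducibility and let $(f_i)_{i \in I}$ be a strong upwards antichain in $\mathcal{A}$, i.e. $f_i \in \mathcal{A}$ for every $i \in I$ and $f_i \oplus f_j \notin \mathcal{A}$ for all $i \neq j$. For $X \subseteq I$ let $\alpha(X)$ be the Medvedev degree of $$(\omega^\omega \setminus \mathcal{A}) \cup \{g \in \omega^\omega \mid \exists i \in X\ (f_i \leq_T g)\}.$$ Then $$\{\alpha(X_1) \otimes \dots \otimes \alpha(X_m) \mid m \geq 1,\ X_1, \dots, X_m \subseteq I\}$$ is a sub-Brouwer algebra of the interval $[\alpha(I), \alpha(\emptyset)]_{\mathcal{M}}$, and as a Brouwer algebra it is isomorphic to $\mathscr{B}_n$, the Brouwer algebra of all upwards closed subsets of the poset $(\mathcal{P}(\{1,\dots,n\}) \setminus \{\emptyset\}, \supseteq)$, ordered under reverse inclusion $\supseteq$. (So the elements of $\mathscr{B}_n$ are the sets $A$ of nonempty subsets of $\{1,\dots,n\}$ such that $X \in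 A$ and $\emptyset \neq Y \subseteq X$ imply $Y \in A$.) -/

import Mathlib

namespace Medvedev

open Nat.Partrec (Code)
open Encodable Denumerable

/-- Turing functionals `Φ`: operators that send an oracle `f : ℕ → ℕ` to a partial function
`Φ f : ℕ →. ℕ`, generated uniformly in `f` by the clauses of `Nat.RecursiveIn`. -/
inductive IsTuringFunctional : ((ℕ → ℕ) → ℕ →. ℕ) → Prop
  | zero : IsTuringFunctional fun _ _ => Part.some 0
  | succ : IsTuringFunctional fun _ n => Part.some (n + 1)
  | left : IsTuringFunctional fun _ n => Part.some n.unpair.1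
  | right : IsTuringFunctional fun _ n => Part.some n.unpair.2
  | oracle : IsTuringFunctional fun f n => Part.some (f n)
  | pair {F G : (ℕ → ℕ) → ℕ →. ℕ} (hF : IsTuringFunctional F) (hG : IsTuringFunctional G) :
      IsTuringFunctional fun f n => (F f n).bind fun a => (G f n).map fun b => Nat.pair a b
  | comp {F G : (ℕ → ℕ) → ℕ →. ℕ} (hF : IsTuringFunctional F) (hG : IsTuringFunctional G) :
      IsTuringFunctional fun f n => (G f n).bind fun a => F f a
  | prec {F G : (ℕ → ℕ) → ℕ →. ℕ} (hF : IsTuringFunctional F) (hG : IsTuringFunctional G) :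
      IsTuringFunctional fun f n => n.unpair.2.rec (F f n.unpair.1) fun y IH =>
        IH.bind fun i => G f (Nat.pair n.unpair.1 (Nat.pair y i))
  | rfind {F : (ℕ → ℕ) → ℕ →. ℕ} (hF : IsTuringFunctional F) :
      IsTuringFunctional fun f a =>
        Nat.rfind fun n => (F f (Nat.pair a n)).map fun m => decide (m = 0)

namespace IsTuringFunctional

theorem of_eq {F G : (ℕ → ℕ) → ℕ →. ℕ} (hF : IsTuringFunctional F)
    (h : ∀ f n, F f n = G f n) : IsTuringFunctional G := by
  have : F = G := by funext f n; exact h f n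
  exact this ▸ hF

theorem of_partrec {g : ℕ →. ℕ} (hg : Nat.Partrec g) : IsTuringFunctional fun _ => g := by
  induction hg with
  | zero => exact .zero
  | succ => exact .succ
  | left => exact .left
  | right => exact .right
  | pair _ _ h1 h2 =>
    exact (IsTuringFunctional.pair h1 h2).of_eq fun _ _ => by
      simp [Seq.seq, Part.bind_map]
  | comp _ _ h1 h2 => exact .comp h1 h2
  | prec _ _ h1 h2 => exact .prec h1 h2
  | rfind _ h1 => exact .rfind h1

/-- Substituting the total output of one functional for the oracle of another one. -/
theorem subst {F G : (ℕ → ℕ) → ℕ →. ℕ} (hF : IsTuringFunctional F)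
    (hG : IsTuringFunctional G) : ∃ H, IsTuringFunctional H ∧
      ∀ g g' : ℕ → ℕ, (∀ n, G g n = Part.some (g' n)) → H g = F g' := by
  induction hF with
  | zero => exact ⟨_, .zero, fun _ _ _ => rfl⟩
  | succ => exact ⟨_, .succ, fun _ _ _ => rfl⟩
  | left => exact ⟨_, .left, fun _ _ _ => rfl⟩
  | right => exact ⟨_, .right, fun _ _ _ => rfl⟩
  | oracle => exact ⟨_, hG, fun _ _ h => funext h⟩
  | pair _ _ h1 h2 =>
    obtain ⟨H1, a1, b1⟩ := h1
    obtain ⟨H2, a2, b2⟩ := h2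
    exact ⟨_, .pair a1 a2, fun g g' h => funext fun n => by simp only [b1 g g' h, b2 g g' h]⟩
  | comp _ _ h1 h2 =>
    obtain ⟨H1, a1, b1⟩ := h1
    obtain ⟨H2, a2, b2⟩ := h2
    exact ⟨_, .comp a1 a2, fun g g' h => funext fun n => by simp only [b1 g g' h, b2 g g' h]⟩
  | prec _ _ h1 h2 =>
    obtain ⟨H1, a1, b1⟩ := h1
    obtain ⟨H2, a2, b2⟩ := h2
    exact ⟨_, .prec a1 a2, fun g g' h => funext fun n => by simp only [b1 g g' h, b2 g g' h]⟩
  | rfind _ h1 =>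
    obtain ⟨H1, a1, b1⟩ := h1
    exact ⟨_, .rfind a1, fun g g' h => funext fun n => by simp only [b1 g g' h]⟩

/-- Case distinction which only runs the functional that is selected. -/
theorem ite {F G : (ℕ → ℕ) → ℕ →. ℕ} {c : (ℕ → ℕ) → ℕ → ℕ} (hF : IsTuringFunctional F)
    (hG : IsTuringFunctional G) (hc : IsTuringFunctional fun f n => Part.some (c f n)) :
    IsTuringFunctional fun f n => if c f n = 0 then F f n else G f n := by
  have hid : IsTuringFunctional fun _ n => Part.some n := of_partrec Nat.Partrec.some
  have key : ∀ {F : (ℕ → ℕ) → ℕ →. ℕ}, IsTuringFunctional F → ∀ k : ℕ → ℕ, Nat.Primrec k →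
      IsTuringFunctional fun f n => ((k (c f n)).rec (Part.some 0)
        fun _ IH => IH.bind fun _ => F f n : Part ℕ) := by
    intro F hF k hk
    have h1 := IsTuringFunctional.prec .zero (hF.comp .left)
    have h2 := h1.comp (hid.pair ((of_partrec (Nat.Partrec.of_primrec hk)).comp hc))
    refine h2.of_eq fun f n => ?_
    simp [PFun.coe_val, Part.bind_some, Part.map_some]
  have hk1 : Nat.Primrec fun x => 1 - x :=
    Primrec.nat_iff.1 (Primrec.nat_sub.comp (Primrec.const 1) Primrec.id)
  have hk2 : Nat.Primrec fun x => 1 - (1 - x) :=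
    Primrec.nat_iff.1 (Primrec.nat_sub.comp (Primrec.const 1)
      (Primrec.nat_sub.comp (Primrec.const 1) Primrec.id))
  have hadd : Nat.Primrec (Nat.unpaired (· + ·)) := Nat.Primrec.add
  have := (of_partrec (Nat.Partrec.of_primrec hadd)).comp
    ((key hF _ hk1).pair (key hG _ hk2))
  refine this.of_eq fun f n => ?_
  rcases Nat.eq_zero_or_pos (c f n) with h | h
  · simp [h, Part.bind_some, Part.map_some, PFun.coe_val, Part.bind_assoc, Part.bind_some_right]
  · obtain ⟨m, hm⟩ := Nat.exists_eq_add_of_le h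
    have e : 1 - (1 + m) = 0 := by omega
    simp [hm, e, Part.bind_some, PFun.coe_val, Part.bind_map, Part.bind_some_right]

end IsTuringFunctional

/-- The first `k` values of `f`. -/
def initSeg (f : ℕ → ℕ) (k : ℕ) : List ℕ := (List.range k).map f

theorem initSeg_prefix (f : ℕ → ℕ) {k l : ℕ} (h : k ≤ l) : initSeg f k <+: initSeg f l := by
  have : List.range k = (List.range l).take k := by simp [h]
  unfold initSeg
  rw [this]
  exact (List.take_prefix _ _).map f

/-- The use principle, with a partial recursive function on initial segments. -/
theorem IsTuringFunctional.exists_use {F : (ℕ → ℕ) → ℕ →. ℕ} (hF : IsTuringFunctional F) :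
    ∃ p : List ℕ × ℕ →. ℕ, Partrec p ∧
      (∀ σ τ n m, σ <+: τ → m ∈ p (σ, n) → m ∈ p (τ, n)) ∧
      ∀ f n m, m ∈ F f n ↔ ∃ k, m ∈ p (initSeg f k, n) := by
  have cst : ∀ g : ℕ → ℕ, Computable g → ∃ p : List ℕ × ℕ →. ℕ, Partrec p ∧
      (∀ σ τ n m, σ <+: τ → m ∈ p (σ, n) → m ∈ p (τ, n)) ∧
      ∀ (f : ℕ → ℕ) n m, m ∈ Part.some (g n) ↔ ∃ k, m ∈ p (initSeg f k, n) := by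
    intro g hg
    exact ⟨fun x => Part.some (g x.2), (hg.comp Computable.snd).partrec, by simp, by simp⟩
  induction hF with
  | zero => exact cst _ (Computable.const 0)
  | succ => exact cst _ Computable.succ
  | left => exact cst _ (Computable.fst.comp Computable.unpair)
  | right => exact cst _ (Computable.snd.comp Computable.unpair)
  | oracle =>
    refine ⟨fun x => (x.1[x.2]? : Option ℕ),
      Computable.ofOption (Computable.list_getElem?.comp Computable.fst Computable.snd), ?_, ?_⟩
    · intro σ τ n m h hm
      simp only [Part.mem_coe, Option.mem_def] at hm ⊢
      obtain ⟨ρ, rfl⟩ := h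
      have := (List.getElem?_eq_some_iff.1 hm).1
      rw [List.getElem?_append_left this, hm]
    · intro f n m
      simp only [Part.mem_some_iff, Part.mem_coe, Option.mem_def, initSeg]
      constructor
      · rintro rfl
        exact ⟨n + 1, by simp⟩
      · rintro ⟨k, hk⟩
        simp only [List.getElem?_map, Option.map_eq_some_iff] at hk
        obtain ⟨a, ha, rfl⟩ := hk
        have := List.getElem?_eq_some_iff.1 ha
        simp at this
        rw [this.2]
  | pair _ _ h1 h2 =>
    obtain ⟨p, p1, p2, p3⟩ := h1
    obtain ⟨q, q1, q2, q3⟩ := h2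
    refine ⟨fun x => (p x).bind fun a => (q x).map fun b => Nat.pair a b, ?_, ?_, ?_⟩
    · exact p1.bind ((q1.comp Computable.fst).map
        (Primrec₂.natPair.to_comp.comp (Computable.snd.comp Computable.fst) Computable.snd).to₂).to₂
    · intro σ τ n m h
      simp only [Part.mem_bind_iff, Part.mem_map_iff]
      rintro ⟨a, ha, b, hb, rfl⟩
      exact ⟨a, p2 _ _ _ _ h ha, b, q2 _ _ _ _ h hb, rfl⟩
    · intro f n m
      simp only [Part.mem_bind_iff, Part.mem_map_iff]
      constructor
      · rintro ⟨a, ha, b, hb, rfl⟩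
        obtain ⟨k, hk⟩ := (p3 _ _ _).1 ha
        obtain ⟨l, hl⟩ := (q3 _ _ _).1 hb
        exact ⟨max k l, a, p2 _ _ _ _ (initSeg_prefix f (le_max_left _ _)) hk, b,
          q2 _ _ _ _ (initSeg_prefix f (le_max_right _ _)) hl, rfl⟩
      · rintro ⟨k, a, ha, b, hb, rfl⟩
        exact ⟨a, (p3 _ _ _).2 ⟨k, ha⟩, b, (q3 _ _ _).2 ⟨k, hb⟩, rfl⟩
  | comp _ _ h1 h2 =>
    obtain ⟨p, p1, p2, p3⟩ := h1
    obtain ⟨q, q1, q2, q3⟩ := h2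
    refine ⟨fun x => (q x).bind fun a => p (x.1, a), ?_, ?_, ?_⟩
    · exact q1.bind (p1.comp
        (Computable.pair (Computable.fst.comp Computable.fst) Computable.snd)).to₂
    · intro σ τ n m h
      simp only [Part.mem_bind_iff]
      rintro ⟨a, ha, hb⟩
      exact ⟨a, q2 _ _ _ _ h ha, p2 _ _ _ _ h hb⟩
    · intro f n m
      simp only [Part.mem_bind_iff]
      constructor
      · rintro ⟨a, ha, hb⟩
        obtain ⟨k, hk⟩ := (q3 _ _ _).1 ha
        obtain ⟨l, hl⟩ := (p3 _ _ _).1 hb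
        exact ⟨max k l, a, q2 _ _ _ _ (initSeg_prefix f (le_max_left _ _)) hk,
          p2 _ _ _ _ (initSeg_prefix f (le_max_right _ _)) hl⟩
      · rintro ⟨k, a, ha, hb⟩
        exact ⟨a, (q3 _ _ _).2 ⟨k, ha⟩, (p3 _ _ _).2 ⟨k, hb⟩⟩
  | prec _ _ h1 h2 =>
    obtain ⟨p, p1, p2, p3⟩ := h1
    obtain ⟨q, q1, q2, q3⟩ := h2
    refine ⟨fun x => x.2.unpair.2.rec (p (x.1, x.2.unpair.1)) fun y IH => IH.bind fun i =>
      q (x.1, Nat.pair x.2.unpair.1 (Nat.pair y i)), ?_, ?_, ?_⟩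
    · have hu := Computable.unpair.comp (Computable.snd (α := List ℕ) (β := ℕ))
      refine Partrec.nat_rec (Computable.snd.comp hu)
        (p1.comp (Computable.fst.pair (Computable.fst.comp hu)))
        (h := fun x z => q (x.1, Nat.pair x.2.unpair.1 (Nat.pair z.1 z.2))) ?_
      refine Partrec.to₂ (f := fun w : (List ℕ × ℕ) × (ℕ × ℕ) =>
        q (w.1.1, Nat.pair w.1.2.unpair.1 (Nat.pair w.2.1 w.2.2)))
        (q1.comp (Computable.pair (Computable.fst.comp Computable.fst) ?_))
      exact Primrec₂.natPair.to_comp.comp ((Computable.fst.comp hu).comp Computable.fst)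
        (Primrec₂.natPair.to_comp.comp (Computable.fst.comp Computable.snd)
          (Computable.snd.comp Computable.snd))
    · intro σ τ n m h
      simp only
      induction n.unpair.2 generalizing m with
      | zero => exact p2 _ _ _ _ h
      | succ y ih =>
        simp only [Part.mem_bind_iff]
        rintro ⟨a, ha, hb⟩
        exact ⟨a, ih _ ha, q2 _ _ _ _ h hb⟩
    · intro f n m
      have mono : ∀ y m k l, k ≤ l →
          m ∈ (Nat.rec (motive := fun _ => Part ℕ) (p (initSeg f k, n.unpair.1)) (fun y IH => IH.bind fun i =>
            q (initSeg f k, Nat.pair n.unpair.1 (Nat.pair y i))) y) →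
          m ∈ (Nat.rec (motive := fun _ => Part ℕ) (p (initSeg f l, n.unpair.1)) (fun y IH => IH.bind fun i =>
            q (initSeg f l, Nat.pair n.unpair.1 (Nat.pair y i))) y) := by
        intro y m k l h
        induction y generalizing m with
        | zero => exact p2 _ _ _ _ (initSeg_prefix f h)
        | succ y ih =>
          simp only [Part.mem_bind_iff]
          rintro ⟨a, ha, hb⟩
          exact ⟨a, ih _ ha, q2 _ _ _ _ (initSeg_prefix f h) hb⟩
      simp only
      generalize n.unpair.2 = y
      induction y generalizing m with
      | zero => exact p3 _ _ _
      | succ y ih =>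
        simp only [Part.mem_bind_iff]
        constructor
        · rintro ⟨a, ha, hb⟩
          obtain ⟨k, hk⟩ := (ih _).1 ha
          obtain ⟨l, hl⟩ := (q3 _ _ _).1 hb
          exact ⟨max k l, a, mono _ _ _ _ (le_max_left _ _) hk,
            q2 _ _ _ _ (initSeg_prefix f (le_max_right _ _)) hl⟩
        · rintro ⟨k, a, ha, hb⟩
          exact ⟨a, (ih _).2 ⟨k, ha⟩, (q3 _ _ _).2 ⟨k, hb⟩⟩
  | rfind _ h1 =>
    obtain ⟨p, p1, p2, p3⟩ := h1
    have mr : ∀ (q : ℕ → Part ℕ) (m : ℕ),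
        (m ∈ Nat.rfind fun n => (q n).map fun i => decide (i = 0)) ↔
        (∃ a ∈ q m, decide (a = 0) = true) ∧
          ∀ {i : ℕ}, i < m → ∃ b ∈ q i, decide (b = 0) = false := by
      intro q m
      refine Nat.mem_rfind.trans (and_congr (Part.mem_map_iff _) ?_)
      exact ⟨fun h i hi => (Part.mem_map_iff _).1 (h hi), fun h i hi => (Part.mem_map_iff _).2 (h hi)⟩
    refine ⟨fun x => Nat.rfind fun n => (p (x.1, Nat.pair x.2 n)).map fun m => decide (m = 0),
      ?_, ?_, ?_⟩
    · refine Partrec.rfind (p := fun (x : List ℕ × ℕ) n => (p (x.1, Nat.pair x.2 n)).map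
        fun m => decide (m = 0)) ?_
      refine Partrec.map (p1.comp (Computable.pair (Computable.fst.comp Computable.fst)
        (Primrec₂.natPair.to_comp.comp (Computable.snd.comp Computable.fst) Computable.snd))) ?_
      exact ((Primrec.eq.decide.comp Primrec.snd (Primrec.const 0)).to_comp).to₂
    · intro σ τ n m h
      simp only [mr]
      rintro ⟨⟨a, ha, ha'⟩, hb⟩
      refine ⟨⟨a, p2 _ _ _ _ h ha, ha'⟩, fun {i} hi => ?_⟩
      obtain ⟨b, hb, hb'⟩ := hb hi
      exact ⟨b, p2 _ _ _ _ h hb, hb'⟩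
    · intro f n m
      simp only [mr]
      constructor
      · rintro ⟨⟨a, ha, ha'⟩, hb⟩
        obtain ⟨k, hk⟩ := (p3 _ _ _).1 ha
        have : ∀ M ≤ m, ∃ l, ∀ i < M, ∃ b ∈ p (initSeg f l, Nat.pair n i),
            decide (b = 0) = false := by
          intro M hM
          induction M with
          | zero => exact ⟨0, by simp⟩
          | succ M ih =>
            obtain ⟨l, hl⟩ := ih (by omega)
            obtain ⟨b, hb, hb'⟩ := hb (show M < m by omega)
            obtain ⟨j, hj⟩ := (p3 _ _ _).1 hb
            refine ⟨max l j, fun i hi => ?_⟩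
            rcases Nat.lt_succ_iff_lt_or_eq.1 hi with hi | rfl
            · obtain ⟨b, hb, hb'⟩ := hl i hi
              exact ⟨b, p2 _ _ _ _ (initSeg_prefix f (le_max_left _ _)) hb, hb'⟩
            · exact ⟨b, p2 _ _ _ _ (initSeg_prefix f (le_max_right _ _)) hj, hb'⟩
        obtain ⟨l, hl⟩ := this m le_rfl
        refine ⟨max k l, ⟨a, p2 _ _ _ _ (initSeg_prefix f (le_max_left _ _)) hk, ha'⟩,
          fun {i} hi => ?_⟩
        obtain ⟨b, hb, hb'⟩ := hl i hi
        exact ⟨b, p2 _ _ _ _ (initSeg_prefix f (le_max_right _ _)) hb, hb'⟩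
      · rintro ⟨k, ⟨a, ha, ha'⟩, hb⟩
        refine ⟨⟨a, (p3 _ _ _).2 ⟨k, ha⟩, ha'⟩, fun {i} hi => ?_⟩
        obtain ⟨b, hb, hb'⟩ := hb hi
        exact ⟨b, (p3 _ _ _).2 ⟨k, hb⟩, hb'⟩

/-- One stage of the computation of the `e`-th Turing functional: the stage `s` codes a bound on
the use and a bound on the number of steps. -/
def phiStage (e : ℕ) (f : ℕ → ℕ) (n s : ℕ) : Option ℕ :=
  Code.evaln s.unpair.2 (ofNat Code e) (Nat.pair (encode (initSeg f s.unpair.1)) n)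

/-- The standard numbering `Φ₀, Φ₁, …` of the Turing functionals, in Kleene normal form. -/
def phi (e : ℕ) (f : ℕ → ℕ) (n : ℕ) : Part ℕ := Nat.rfindOpt (phiStage e f n)

theorem IsTuringFunctional.exists_index {F : (ℕ → ℕ) → ℕ →. ℕ} (hF : IsTuringFunctional F) :
    ∃ e, ∀ f n, phi e f n = F f n := by
  obtain ⟨p, p1, -, p3⟩ := hF.exists_use
  obtain ⟨c, hc⟩ := Code.exists_code.1 p1
  have hc' : ∀ σ n m, m ∈ c.eval (Nat.pair (encode σ) n) ↔ m ∈ p (σ, n) := by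
    intro σ n m
    rw [hc, show Nat.pair (encode σ) n = encode (σ, n) from rfl]
    simp
  have st : ∀ f n m, (∃ s, m ∈ phiStage (encode c) f n s) ↔ m ∈ F f n := by
    intro f n m
    rw [p3]
    simp only [phiStage, ofNat_encode]
    constructor
    · rintro ⟨s, hs⟩
      exact ⟨_, (hc' _ _ _).1 (Code.evaln_sound hs)⟩
    · rintro ⟨k, hk⟩
      obtain ⟨t, ht⟩ := Code.evaln_complete.1 ((hc' _ _ _).2 hk)
      exact ⟨Nat.pair k t, by simpa using ht⟩
  refine ⟨encode c, fun f n => Part.ext fun m => ⟨fun h => (st _ _ _).1 (Nat.rfindOpt_spec h),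
    fun h => ?_⟩⟩
  obtain ⟨s, hs⟩ := (st _ _ _).2 h
  have hd : (phi (encode c) f n).Dom := Nat.rfindOpt_dom.2 ⟨s, m, hs⟩
  have h2 := (st _ _ _).1 (Nat.rfindOpt_spec (Part.get_mem hd))
  rw [Part.mem_unique h h2]
  exact Part.get_mem hd

theorem isTuringFunctional_initSeg :
    IsTuringFunctional fun f n => Part.some (encode (initSeg f n)) := by
  have happ : Nat.Partrec fun z => Part.some (encode
      ((((decode (α := List ℕ) z.unpair.1).getD [])) ++ [z.unpair.2])) := by
    refine Nat.Partrec.of_eq (Partrec.nat_iff.1 (Computable.partrec (f := fun z : ℕ => encode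
      ((((decode (α := List ℕ) z.unpair.1).getD [])) ++ [z.unpair.2])) ?_)) fun _ => rfl
    refine Primrec.to_comp (Primrec.encode.comp (Primrec.list_concat.comp ?_ ?_))
    · exact Primrec.option_getD.comp (Primrec.decode.comp (Primrec.fst.comp Primrec.unpair))
        (Primrec.const [])
    · exact Primrec.snd.comp Primrec.unpair
  have hid : IsTuringFunctional fun _ n => Part.some n := .of_partrec Nat.Partrec.some
  have hstep := (IsTuringFunctional.of_partrec happ).comp
    ((IsTuringFunctional.right.comp .right).pair
      (IsTuringFunctional.oracle.comp (IsTuringFunctional.left.comp .right)))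
  have := (IsTuringFunctional.prec .zero hstep).comp (IsTuringFunctional.zero.pair hid)
  refine this.of_eq fun f n => ?_
  simp only [Part.map_some, Part.bind_some, Nat.unpair_pair]
  induction n with
  | zero => simp [initSeg]
  | succ n ih => simp only [ih, Part.bind_some, encodek]; simp [initSeg, List.range_succ]

/-- The numbering of the Turing functionals is uniform. -/
theorem isTuringFunctional_phi :
    IsTuringFunctional fun f z => phi z.unpair.1 f z.unpair.2 := by
  -- `z` codes `((e, n), s)`
  have hst : Nat.Partrec fun z => Part.some (encode (Code.evaln z.unpair.2.unpair.2.unpair.2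
      (ofNat Code z.unpair.2.unpair.1.unpair.1)
      (Nat.pair z.unpair.1 z.unpair.2.unpair.1.unpair.2))) := by
    have hl := Primrec.fst.comp Primrec.unpair
    have hr := Primrec.snd.comp Primrec.unpair
    refine Nat.Partrec.of_primrec (Primrec.nat_iff.1 (Primrec.encode.comp ?_))
    exact Code.primrec_evaln.comp (Primrec.pair (Primrec.pair (hr.comp (hr.comp hr))
      ((Primrec.ofNat Code).comp (hl.comp (hl.comp hr))))
      (Primrec₂.natPair.comp hl (hr.comp (hl.comp hr))))
  have hid : IsTuringFunctional fun _ n => Part.some n := .of_partrec Nat.Partrec.some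
  have hS := (IsTuringFunctional.of_partrec hst).comp
    ((isTuringFunctional_initSeg.comp (IsTuringFunctional.left.comp .right)).pair hid)
  have hsub : Nat.Partrec fun x => Part.some (1 - x) := Nat.Partrec.of_primrec
    (Primrec.nat_iff.1 (Primrec.nat_sub.comp (Primrec.const 1) Primrec.id))
  have hpred : Nat.Partrec fun x => Part.some (x - 1) := Nat.Partrec.of_primrec
    (Primrec.nat_iff.1 (Primrec.nat_sub.comp Primrec.id (Primrec.const 1)))
  have hR := IsTuringFunctional.rfind ((IsTuringFunctional.of_partrec hsub).comp hS)
  have := (IsTuringFunctional.of_partrec hpred).comp (hS.comp (hid.pair hR))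
  refine this.of_eq fun f z => ?_
  have hbool : ∀ o : Option ℕ, decide (1 - encode o = 0) = o.isSome := by
    rintro (_ | a) <;> simp
  simp only [Part.map_some, Part.bind_some, Nat.unpair_pair, hbool, Part.bind_map, phi, Nat.rfindOpt, phiStage, Part.bind_assoc]
  refine Part.ext fun m => ?_
  simp only [Part.mem_bind_iff]
  refine exists_congr fun s => and_congr_right fun hs => ?_
  have := Nat.rfind_spec hs
  simp only [Part.mem_some_iff] at this
  obtain ⟨a, ha⟩ := Option.isSome_iff_exists.1 this.symm
  simp [ha]

/-- Medvedev reducibility `A ≤ B` of mass problems: some Turing functional sends every element of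
`B` to a (total) element of `A`. -/
def Reduces (A B : Set (ℕ → ℕ)) : Prop :=
  ∃ F, IsTuringFunctional F ∧ ∀ g ∈ B, ∃ f ∈ A, ∀ n, F g n = Part.some (f n)

/-- The join `f ⊕ g` of two functions. -/
def join (f g : ℕ → ℕ) (n : ℕ) : ℕ := if n % 2 = 0 then f (n / 2) else g (n / 2)

/-- The concatenation `a ⌢ f`. -/
def cons (a : ℕ) (f : ℕ → ℕ) (n : ℕ) : ℕ := if n = 0 then a else f (n - 1)

/-- `A ⊕ B`. -/
def sum (A B : Set (ℕ → ℕ)) : Set (ℕ → ℕ) := {h | ∃ f ∈ A, ∃ g ∈ B, h = join f g}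

/-- `A ⊗ B`. -/
def prod (A B : Set (ℕ → ℕ)) : Set (ℕ → ℕ) :=
  {h | ∃ f ∈ A, h = cons 0 f} ∪ {h | ∃ g ∈ B, h = cons 1 g}

/-- `A → B`, the set of all `e ⌢ f` such that `Φₑ (f ⊕ g) ∈ B` for all `g ∈ A`. -/
def imp (A B : Set (ℕ → ℕ)) : Set (ℕ → ℕ) :=
  {h | ∃ e f, h = cons e f ∧
    ∀ g ∈ A, ∃ b ∈ B, ∀ n, phi e (join f g) n = Part.some (b n)}

theorem join_even (f g : ℕ → ℕ) (n : ℕ) : join f g (2 * n) = f n := by simp [join]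

theorem join_odd (f g : ℕ → ℕ) (n : ℕ) : join f g (2 * n + 1) = g n := by
  have : (2 * n + 1) / 2 = n := by omega
  simp [join, this, Nat.add_mod]

theorem cons_zero (a : ℕ) (f : ℕ → ℕ) : cons a f 0 = a := rfl

theorem cons_succ (a : ℕ) (f : ℕ → ℕ) (n : ℕ) : cons a f (n + 1) = f n := rfl

theorem isTuringFunctional_query {k : ℕ → ℕ} (hk : Primrec k) :
    IsTuringFunctional fun f n => Part.some (f (k n)) := by
  refine (IsTuringFunctional.oracle.comp (IsTuringFunctional.of_partrec
    (Nat.Partrec.of_primrec (Primrec.nat_iff.1 hk)))).of_eq fun f n => ?_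
  simp [PFun.coe_val]

theorem isTuringFunctional_const {k : ℕ → ℕ} (hk : Primrec k) :
    IsTuringFunctional fun _ n => Part.some (k n) :=
  IsTuringFunctional.of_partrec (Nat.Partrec.of_primrec (Primrec.nat_iff.1 hk))

theorem primrec_mod_two : Primrec fun n : ℕ => n % 2 :=
  Primrec.nat_mod.comp Primrec.id (Primrec.const 2)

theorem primrec_div_two : Primrec fun n : ℕ => n / 2 :=
  Primrec.nat_div.comp Primrec.id (Primrec.const 2)

theorem primrec_even : Primrec fun n : ℕ => 2 * n :=
  Primrec.nat_mul.comp (Primrec.const 2) Primrec.id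

theorem primrec_odd : Primrec fun n : ℕ => 2 * n + 1 :=
  Primrec.succ.comp primrec_even

theorem primrec_sub_one : Primrec fun n : ℕ => n - 1 :=
  Primrec.nat_sub.comp Primrec.id (Primrec.const 1)

theorem some_ite {c : Prop} [Decidable c] (a b : ℕ) :
    (if c then Part.some a else Part.some b) = Part.some (if c then a else b) := by
  split <;> rfl

theorem isTuringFunctional_join {a b : (ℕ → ℕ) → ℕ → ℕ}
    (ha : IsTuringFunctional fun f n => Part.some (a f n))
    (hb : IsTuringFunctional fun f n => Part.some (b f n)) :
    IsTuringFunctional fun f n => Part.some (join (a f) (b f) n) := by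
  have hd := isTuringFunctional_const primrec_div_two
  refine ((ha.comp hd).ite (hb.comp hd) (isTuringFunctional_const primrec_mod_two)).of_eq
    fun f n => ?_
  simp only [Part.bind_some, some_ite, join]

theorem isTuringFunctional_cons (k : ℕ) :
    IsTuringFunctional fun f n => Part.some (cons k f n) := by
  refine ((isTuringFunctional_const (Primrec.const k)).ite
    (isTuringFunctional_query primrec_sub_one) (isTuringFunctional_const Primrec.id)).of_eq
    fun f n => ?_
  simp only [some_ite, cons, id]

theorem Reduces.of_total {A B : Set (ℕ → ℕ)} {G : (ℕ → ℕ) → ℕ → ℕ}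
    (hG : IsTuringFunctional fun f n => Part.some (G f n)) (h : ∀ g ∈ B, G g ∈ A) :
    Reduces A B :=
  ⟨_, hG, fun g hg => ⟨_, h g hg, fun _ => rfl⟩⟩

theorem Reduces.of_subset {A B : Set (ℕ → ℕ)} (h : B ⊆ A) : Reduces A B :=
  .of_total .oracle h

theorem Reduces.trans {A B C : Set (ℕ → ℕ)} (h1 : Reduces A B) (h2 : Reduces B C) :
    Reduces A C := by
  obtain ⟨F, hF, h1⟩ := h1
  obtain ⟨G, hG, h2⟩ := h2
  obtain ⟨H, hH, h3⟩ := hF.subst hG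
  refine ⟨H, hH, fun g hg => ?_⟩
  obtain ⟨g', hg', e⟩ := h2 g hg
  obtain ⟨f, hf, e'⟩ := h1 g' hg'
  exact ⟨f, hf, fun n => by rw [h3 g g' e, e']⟩

theorem reduces_sum_left (A B : Set (ℕ → ℕ)) : Reduces A (sum A B) := by
  refine .of_total (isTuringFunctional_query primrec_even) ?_
  rintro _ ⟨f, hf, g, -, rfl⟩
  simpa only [join_even] using hf

theorem reduces_sum_right (A B : Set (ℕ → ℕ)) : Reduces B (sum A B) := by
  refine .of_total (isTuringFunctional_query primrec_odd) ?_
  rintro _ ⟨f, -, g, hg, rfl⟩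
  simpa only [join_odd] using hg

theorem sum_reduces {A B C : Set (ℕ → ℕ)} (h1 : Reduces A C) (h2 : Reduces B C) :
    Reduces (sum A B) C := by
  obtain ⟨F, hF, h1⟩ := h1
  obtain ⟨G, hG, h2⟩ := h2
  have hd := isTuringFunctional_const primrec_div_two
  refine ⟨_, (hF.comp hd).ite (hG.comp hd) (isTuringFunctional_const primrec_mod_two),
    fun c hc => ?_⟩
  obtain ⟨f, hf, e1⟩ := h1 c hc
  obtain ⟨g, hg, e2⟩ := h2 c hc
  exact ⟨_, ⟨f, hf, g, hg, rfl⟩, fun n => by simp only [Part.bind_some, e1, e2, some_ite, join]⟩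

theorem prod_reduces_left (A B : Set (ℕ → ℕ)) : Reduces (prod A B) A :=
  .of_total (isTuringFunctional_cons 0) fun g hg => Or.inl ⟨g, hg, rfl⟩

theorem prod_reduces_right (A B : Set (ℕ → ℕ)) : Reduces (prod A B) B :=
  .of_total (isTuringFunctional_cons 1) fun g hg => Or.inr ⟨g, hg, rfl⟩

theorem reduces_prod {A B C : Set (ℕ → ℕ)} (h1 : Reduces C A) (h2 : Reduces C B) :
    Reduces C (prod A B) := by
  obtain ⟨F, hF, h1⟩ := h1
  obtain ⟨G, hG, h2⟩ := h2
  obtain ⟨F', hF', e1⟩ := hF.subst (isTuringFunctional_query Primrec.succ)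
  obtain ⟨G', hG', e2⟩ := hG.subst (isTuringFunctional_query Primrec.succ)
  refine ⟨_, hF'.ite hG' (isTuringFunctional_query (Primrec.const 0)), ?_⟩
  rintro _ (⟨f, hf, rfl⟩ | ⟨g, hg, rfl⟩)
  · obtain ⟨c, hc, e⟩ := h1 f hf
    refine ⟨c, hc, fun n => ?_⟩
    simp only [cons_zero, if_true]
    rw [e1 (cons 0 f) f fun _ => rfl, e]
  · obtain ⟨c, hc, e⟩ := h2 g hg
    refine ⟨c, hc, fun n => ?_⟩
    simp only [cons_zero, one_ne_zero, if_false]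
    rw [e2 (cons 1 g) g fun _ => rfl, e]

theorem reduces_sum_imp (A B : Set (ℕ → ℕ)) : Reduces B (sum A (imp A B)) := by
  have hJ : IsTuringFunctional fun h n =>
      Part.some (join (fun n => h (2 * (n + 1) + 1)) (fun n => h (2 * n)) n) :=
    isTuringFunctional_join (a := fun h n => h (2 * (n + 1) + 1)) (b := fun h n => h (2 * n))
      (isTuringFunctional_query (primrec_odd.comp Primrec.succ))
      (isTuringFunctional_query primrec_even)
  obtain ⟨H, hH, e⟩ := isTuringFunctional_phi.subst hJ
  refine ⟨_, hH.comp ((isTuringFunctional_query (Primrec.const (2 * 0 + 1))).pair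
    (isTuringFunctional_const Primrec.id)), ?_⟩
  rintro _ ⟨g, hg, _, ⟨i, f, rfl, h⟩, rfl⟩
  obtain ⟨b, hb, hb'⟩ := h g hg
  refine ⟨b, hb, fun n => ?_⟩
  rw [e _ (join f g) fun n => by simp only [join_odd, join_even, cons_succ]]
  simp only [join_odd, cons_zero, Part.map_some, Part.bind_some, Nat.unpair_pair, id, hb']

theorem imp_reduces {A B C : Set (ℕ → ℕ)} (h : Reduces B (sum A C)) : Reduces (imp A B) C := by
  obtain ⟨F, hF, h⟩ := h
  have hJ : IsTuringFunctional fun h n =>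
      Part.some (join (fun n => h (2 * n + 1)) (fun n => h (2 * n)) n) :=
    isTuringFunctional_join (a := fun h n => h (2 * n + 1)) (b := fun h n => h (2 * n))
      (isTuringFunctional_query primrec_odd) (isTuringFunctional_query primrec_even)
  obtain ⟨G, hG, e⟩ := hF.subst hJ
  obtain ⟨i, hi⟩ := hG.exists_index
  refine .of_total (isTuringFunctional_cons i) fun c hc => ⟨i, c, rfl, fun g hg => ?_⟩
  obtain ⟨b, hb, hb'⟩ := h _ ⟨g, hg, c, hc, rfl⟩
  refine ⟨b, hb, fun n => ?_⟩
  rw [hi, e _ (join g c) fun n => by simp only [join_odd, join_even], hb']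

/-- Mass problems, preordered by Medvedev reducibility. -/
def MassProblem : Type := Set (ℕ → ℕ)

instance : Preorder MassProblem where
  le A B := Reduces A B
  le_refl _ := .of_subset subset_rfl
  le_trans _ _ _ := .trans

/-- The Medvedev degrees. -/
def MedvedevDegree : Type := Antisymmetrization MassProblem (· ≤ ·)

instance : PartialOrder MedvedevDegree :=
  inferInstanceAs (PartialOrder (Antisymmetrization MassProblem (· ≤ ·)))

/-- The Medvedev degree of a mass problem. -/
def deg (A : Set (ℕ → ℕ)) : MedvedevDegree :=
  toAntisymmetrization (α := MassProblem) (· ≤ ·) A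

theorem deg_le_deg {A B : Set (ℕ → ℕ)} : deg A ≤ deg B ↔ Reduces A B := Iff.rfl

theorem deg_surjective : Function.Surjective deg := Quotient.mk_surjective

theorem deg_eq_deg {A B : Set (ℕ → ℕ)} : deg A = deg B ↔ Reduces A B ∧ Reduces B A :=
  le_antisymm_iff

/-- The operation on degrees induced by an operation on mass problems. -/
def lift₂ (op : Set (ℕ → ℕ) → Set (ℕ → ℕ) → Set (ℕ → ℕ))
    (h : ∀ A A' B B', deg A = deg A' → deg B = deg B' → Reduces (op A B) (op A' B'))
    (a b : MedvedevDegree) : MedvedevDegree :=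
  Quotient.liftOn₂ a b (fun A B => deg (op A B)) fun A B A' B' hA hB =>
    have hA : deg A = deg A' := deg_eq_deg.2 hA
    have hB : deg B = deg B' := deg_eq_deg.2 hB
    deg_eq_deg.2 ⟨h _ _ _ _ hA hB, h _ _ _ _ hA.symm hB.symm⟩

/-- The Medvedev lattice as a Brouwer algebra. The join `⊔` is `⊕`, the meet `⊓` is `⊗`, and the
Brouwer implication `a → b` is `b \ a`. -/
instance : CoheytingAlgebra MedvedevDegree where
  sup := lift₂ sum fun A A' B B' hA hB =>
    sum_reduces ((deg_eq_deg.1 hA).1.trans (reduces_sum_left _ _))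
      ((deg_eq_deg.1 hB).1.trans (reduces_sum_right _ _))
  inf := lift₂ prod fun A A' B B' hA hB =>
    reduces_prod ((prod_reduces_left _ _).trans (deg_eq_deg.1 hA).1)
      ((prod_reduces_right _ _).trans (deg_eq_deg.1 hB).1)
  sdiff := lift₂ (fun B A => imp A B) fun B B' A A' hB hA =>
    imp_reduces ((deg_eq_deg.1 hB).1.trans ((reduces_sum_imp A' B').trans
      (sum_reduces ((deg_eq_deg.1 hA).2.trans (reduces_sum_left _ _)) (reduces_sum_right _ _))))
  bot := deg Set.univ
  top := deg ∅
  hnot := lift₂ (fun B A => imp A B) (fun B B' A A' hB hA =>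
    imp_reduces ((deg_eq_deg.1 hB).1.trans ((reduces_sum_imp A' B').trans
      (sum_reduces ((deg_eq_deg.1 hA).2.trans (reduces_sum_left _ _))
        (reduces_sum_right _ _))))) (deg ∅)
  le_sup_left := by
    intro a b
    obtain ⟨A, rfl⟩ := deg_surjective a
    obtain ⟨B, rfl⟩ := deg_surjective b
    exact reduces_sum_left A B
  le_sup_right := by
    intro a b
    obtain ⟨A, rfl⟩ := deg_surjective a
    obtain ⟨B, rfl⟩ := deg_surjective b
    exact reduces_sum_right A B
  sup_le := by
    intro a b c
    obtain ⟨A, rfl⟩ := deg_surjective a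
    obtain ⟨B, rfl⟩ := deg_surjective b
    obtain ⟨C, rfl⟩ := deg_surjective c
    exact sum_reduces (A := A) (B := B) (C := C)
  inf_le_left := by
    intro a b
    obtain ⟨A, rfl⟩ := deg_surjective a
    obtain ⟨B, rfl⟩ := deg_surjective b
    exact prod_reduces_left A B
  inf_le_right := by
    intro a b
    obtain ⟨A, rfl⟩ := deg_surjective a
    obtain ⟨B, rfl⟩ := deg_surjective b
    exact prod_reduces_right A B
  le_inf := by
    intro c a b
    obtain ⟨A, rfl⟩ := deg_surjective a
    obtain ⟨B, rfl⟩ := deg_surjective b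
    obtain ⟨C, rfl⟩ := deg_surjective c
    exact reduces_prod (A := A) (B := B) (C := C)
  bot_le := by
    intro a
    obtain ⟨A, rfl⟩ := deg_surjective a
    exact Reduces.of_subset (Set.subset_univ A)
  le_top := by
    intro a
    obtain ⟨A, rfl⟩ := deg_surjective a
    exact Reduces.of_subset (Set.empty_subset A)
  sdiff_le_iff := by
    intro b a c
    obtain ⟨A, rfl⟩ := deg_surjective a
    obtain ⟨B, rfl⟩ := deg_surjective b
    obtain ⟨C, rfl⟩ := deg_surjective c
    exact ⟨fun h => (reduces_sum_imp A B).trans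
      (sum_reduces (reduces_sum_left A C) (Reduces.trans h (reduces_sum_right A C))),
      fun h => imp_reduces (A := A) (B := B) (C := C) h⟩
  top_sdiff _ := rfl

/-- The interval `[x, y]` of a Brouwer algebra is a Brouwer algebra, with implication
`(u → v) ⊕ x`. -/
instance intervalCoheytingAlgebra {α : Type*} [CoheytingAlgebra α] {x y : α} [Fact (x ≤ y)] :
    CoheytingAlgebra (Set.Icc x y) where
  sdiff v u := ⟨(v.1 \ u.1) ⊔ x, le_sup_right,
    sup_le (sdiff_le.trans v.2.2) (v.2.1.trans v.2.2)⟩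
  hnot u := ⟨(y \ u.1) ⊔ x, le_sup_right, sup_le sdiff_le (Fact.out : x ≤ y)⟩
  sdiff_le_iff v u w := by
    change (v.1 \ u.1) ⊔ x ≤ w.1 ↔ v.1 ≤ u.1 ⊔ w.1
    rw [sup_le_iff, sdiff_le_iff, and_iff_left w.2.1]
  top_sdiff _ := rfl

/-- A sub-Brouwer algebra: a subset closed under `⊕`, `⊗`, `→` and containing `0` and `1`. -/
structure SubBrouwerAlgebra (α : Type*) [CoheytingAlgebra α] where
  carrier : Set α
  sup_mem : ∀ a ∈ carrier, ∀ b ∈ carrier, a ⊔ b ∈ carrier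
  inf_mem : ∀ a ∈ carrier, ∀ b ∈ carrier, a ⊓ b ∈ carrier
  sdiff_mem : ∀ a ∈ carrier, ∀ b ∈ carrier, b \ a ∈ carrier
  bot_mem : ⊥ ∈ carrier
  top_mem : ⊤ ∈ carrier

/-- A sub-Brouwer algebra is a Brouwer algebra with the restricted operations. -/
instance {α : Type*} [CoheytingAlgebra α] (L : SubBrouwerAlgebra α) :
    CoheytingAlgebra L.carrier where
  sup a b := ⟨a.1 ⊔ b.1, L.sup_mem _ a.2 _ b.2⟩
  inf a b := ⟨a.1 ⊓ b.1, L.inf_mem _ a.2 _ b.2⟩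
  sdiff b a := ⟨b.1 \ a.1, L.sdiff_mem _ a.2 _ b.2⟩
  bot := ⟨⊥, L.bot_mem⟩
  top := ⟨⊤, L.top_mem⟩
  hnot a := ⟨⊤ \ a.1, L.sdiff_mem _ a.2 _ L.top_mem⟩
  le_sup_left a b := le_sup_left (a := a.1) (b := b.1)
  le_sup_right a b := le_sup_right (a := a.1) (b := b.1)
  sup_le a b c := sup_le (a := a.1) (b := b.1) (c := c.1)
  inf_le_left a b := inf_le_left (a := a.1) (b := b.1)
  inf_le_right a b := inf_le_right (a := a.1) (b := b.1)
  le_inf _ _ _ h1 h2 := _root_.le_inf (α := α) h1 h2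
  bot_le a := bot_le (a := a.1)
  le_top a := le_top (a := a.1)
  sdiff_le_iff a b c := sdiff_le_iff (a := a.1) (b := b.1) (c := c.1)
  top_sdiff _ := rfl

/-- Turing reducibility `f ≤_T g` between total functions. -/
def TuringLE (f g : ℕ → ℕ) : Prop := TuringReducible (f : ℕ →. ℕ) (g : ℕ →. ℕ)

/-- The upper cone `C(X)`. -/
def upperCone (X : Set (ℕ → ℕ)) : Set (ℕ → ℕ) := {f | ∃ g ∈ X, TuringLE g f}

/-- Downward closure under Turing reducibility. -/
def TuringDownClosed (A : Set (ℕ → ℕ)) : Prop := ∀ f ∈ A, ∀ g, TuringLE g f → g ∈ A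

/-- `(f i)` is a strong upwards antichain in `A`. -/
def IsStrongUpAntichain {I : Type*} (A : Set (ℕ → ℕ)) (f : I → ℕ → ℕ) : Prop :=
  (∀ i, f i ∈ A) ∧ ∀ i j, i ≠ j → join (f i) (f j) ∉ A

/-- The mass problem `Aᶜ ∪ C({f i | i ∈ X})`. -/
def alphaProblem {I : Type*} (A : Set (ℕ → ℕ)) (f : I → ℕ → ℕ) (X : Set I) : Set (ℕ → ℕ) :=
  Aᶜ ∪ upperCone (f '' X)

theorem deg_alphaProblem_anti {I : Type*} (A : Set (ℕ → ℕ)) (f : I → ℕ → ℕ) {X Y : Set I}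
    (h : X ⊆ Y) : deg (alphaProblem A f Y) ≤ deg (alphaProblem A f X) := by
  refine Reduces.of_subset (Set.union_subset_union_right _ ?_)
  rintro g ⟨k, hk, hkg⟩
  exact ⟨k, Set.image_mono h hk, hkg⟩

instance {I : Type*} (A : Set (ℕ → ℕ)) (f : I → ℕ → ℕ) :
    Fact (deg (alphaProblem A f Set.univ) ≤ deg (alphaProblem A f ∅)) :=
  ⟨deg_alphaProblem_anti A f (Set.empty_subset _)⟩

/-- The interval `[α(I), α(∅)]` of the Medvedev lattice. -/
abbrev AlphaInterval {I : Type*} (A : Set (ℕ → ℕ)) (f : I → ℕ → ℕ) : Type :=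
  Set.Icc (deg (alphaProblem A f Set.univ)) (deg (alphaProblem A f ∅))

/-- The map `α` from `P(I)` to `[α(I), α(∅)]`, where `α(X)` is the degree of
`Aᶜ ∪ C({f i | i ∈ X})`. -/
def alpha {I : Type*} (A : Set (ℕ → ℕ)) (f : I → ℕ → ℕ) (X : Set I) : AlphaInterval A f :=
  ⟨deg (alphaProblem A f X), deg_alphaProblem_anti A f (Set.subset_univ X),
    deg_alphaProblem_anti A f (Set.empty_subset X)⟩

/-- The poset `(P({1, …, n}) \ {∅}, ⊇)`. -/
abbrev NonemptySubsets (n : ℕ) : Type := {X : Set (Set.Icc 1 n) // X.Nonempty}ᵒᵈ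

/-- The Brouwer algebra `ℬₙ` of the upwards closed subsets of `(P({1, …, n}) \ {∅}, ⊇)`, ordered
under reverse inclusion (this is how Mathlib orders `UpperSet`). -/
abbrev BrouwerB (n : ℕ) : Type := UpperSet (NonemptySubsets n)

end Medvedev

namespace Medvedev

open Nat.Partrec (Code)
open Encodable Denumerable

/-! Each `α(X)` is the degree of a mass problem `U` that is upwards closed under Turing
reducibility, and for such `U` Medvedev reducibility is plain inclusion: `U ≤ C` iff `C ⊆ U`
(`TuringUpClosed.reduces_iff`). Since an element of `A` computes at most one `f i`, the interval
satisfies `α(X) ⊕ α(Y) = α(X ∩ Y)` and `α(X) → α(Y) = α(Y ∪ Xᶜ)`, and `α(X) ≤ α(Y)` iff `Y ⊆ X`.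

The computability-theoretic core is `inf_deg_sdiff`: implication from an upwards closed `U`
distributes over `⊗`. A functional from `U ⊕ C` to `B₁ ⊗ B₂` chooses its side after reading finitely
many values. Overwriting a finite part of an element of `U` keeps it in `U`, so the side can be
fixed by a finite prefix found from `C` alone.

Hence finite meets of the `α(X)` are closed under `→`: a meet in the antecedent becomes a join, a
meet in the consequent is pulled out. As `0` is meet-prime, the same distributivity makes every
`α(X)` meet-prime, so a meet `z` is determined by the nonempty `Y` with `z ≤ α(Y)`. These `Y` are
closed under nonempty subsets, and every family closed in this way arises because `I` is finite. The
set `Y = ∅` carries no information, as `α(∅)` is the top. -/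

/-! ### Turing functionals and Turing reducibility. -/

theorem IsTuringFunctional.recursiveIn {F : (ℕ → ℕ) → ℕ →. ℕ} (hF : IsTuringFunctional F)
    (g : ℕ → ℕ) : Nat.RecursiveIn {(g : ℕ →. ℕ)} (F g) := by
  induction hF with
  | zero => exact .zero
  | succ => exact .succ
  | left => exact .left
  | right => exact .right
  | oracle => exact .oracle _ rfl
  | pair _ _ h1 h2 =>
    exact (Nat.RecursiveIn.pair h1 h2).of_eq fun _ => by simp [Seq.seq, Part.bind_map]
  | comp _ _ h1 h2 => exact .comp h1 h2
  | prec _ _ h1 h2 => exact .prec h1 h2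
  | rfind _ h1 => exact .rfind h1

/-- A derivation relative to the fixed oracle `g` becomes a functional once the oracle is read as a
variable. -/
theorem exists_isTuringFunctional_of_recursiveIn {g : ℕ → ℕ} {h : ℕ →. ℕ}
    (hh : Nat.RecursiveIn {(g : ℕ →. ℕ)} h) : ∃ F, IsTuringFunctional F ∧ F g = h := by
  induction hh with
  | zero => exact ⟨_, .zero, rfl⟩
  | succ => exact ⟨_, .succ, rfl⟩
  | left => exact ⟨_, .left, rfl⟩
  | right => exact ⟨_, .right, rfl⟩
  | oracle k hk =>
    obtain rfl : k = _ := hk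
    exact ⟨_, .oracle, rfl⟩
  | pair _ _ h1 h2 =>
    obtain ⟨F, hF, rfl⟩ := h1
    obtain ⟨G, hG, rfl⟩ := h2
    exact ⟨_, .pair hF hG, funext fun _ => by simp [Seq.seq, Part.bind_map]⟩
  | comp _ _ h1 h2 =>
    obtain ⟨F, hF, rfl⟩ := h1
    obtain ⟨G, hG, rfl⟩ := h2
    exact ⟨_, .comp hF hG, rfl⟩
  | prec _ _ h1 h2 =>
    obtain ⟨F, hF, rfl⟩ := h1
    obtain ⟨G, hG, rfl⟩ := h2
    exact ⟨_, .prec hF hG, rfl⟩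
  | rfind _ h1 =>
    obtain ⟨F, hF, rfl⟩ := h1
    exact ⟨_, .rfind hF, rfl⟩

theorem turingLE_iff {g h : ℕ → ℕ} :
    TuringLE g h ↔ ∃ F, IsTuringFunctional F ∧ ∀ n, F h n = Part.some (g n) := by
  unfold TuringLE TuringReducible
  rw [RecursiveIn.iff_nat]
  constructor
  · intro H
    obtain ⟨F, hF, e⟩ := exists_isTuringFunctional_of_recursiveIn H
    exact ⟨F, hF, fun n => congrFun e n⟩
  · rintro ⟨F, hF, e⟩
    exact (hF.recursiveIn h).of_eq e

theorem TuringLE.refl (g : ℕ → ℕ) : TuringLE g g := TuringReducible.refl _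

theorem TuringLE.trans {f g h : ℕ → ℕ} (h1 : TuringLE f g) (h2 : TuringLE g h) : TuringLE f h :=
  TuringReducible.trans h1 h2

theorem turingLE_of_total {G : (ℕ → ℕ) → ℕ → ℕ}
    (hG : IsTuringFunctional fun f n => Part.some (G f n)) (g : ℕ → ℕ) : TuringLE (G g) g :=
  turingLE_iff.2 ⟨_, hG, fun _ => rfl⟩

theorem turingLE_join_left (g h : ℕ → ℕ) : TuringLE g (join g h) := by
  simpa only [join_even] using turingLE_of_total (isTuringFunctional_query primrec_even) (join g h)

theorem turingLE_join_right (g h : ℕ → ℕ) : TuringLE h (join g h) := by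
  simpa only [join_odd] using turingLE_of_total (isTuringFunctional_query primrec_odd) (join g h)

theorem TuringLE.join {f g h : ℕ → ℕ} (h1 : TuringLE f h) (h2 : TuringLE g h) :
    TuringLE (join f g) h := by
  obtain ⟨F, hF, e1⟩ := turingLE_iff.1 h1
  obtain ⟨G, hG, e2⟩ := turingLE_iff.1 h2
  have hd := isTuringFunctional_const primrec_div_two
  refine turingLE_iff.2 ⟨_, (hF.comp hd).ite (hG.comp hd)
    (isTuringFunctional_const primrec_mod_two), fun n => ?_⟩
  simp only [Part.bind_some, e1, e2, some_ite, Medvedev.join]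

/-! ### Upwards closed mass problems and finite modifications. -/

/-- Upward closure under Turing reducibility. -/
def TuringUpClosed (U : Set (ℕ → ℕ)) : Prop := ∀ g ∈ U, ∀ h, TuringLE g h → h ∈ U

/-- A reduction sends `c ∈ C` to an element of `U` computable from `c`, so `c` is itself in `U`;
conversely the identity is a reduction. -/
theorem TuringUpClosed.reduces_iff {U C : Set (ℕ → ℕ)} (hU : TuringUpClosed U) :
    Reduces U C ↔ C ⊆ U := by
  refine ⟨?_, .of_subset⟩
  rintro ⟨F, hF, h⟩ c hc
  obtain ⟨u, hu, e⟩ := h c hc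
  exact hU u hu c (turingLE_iff.2 ⟨F, hF, e⟩)

/-- The function `g` with its first `k` values replaced by the entries of `l`. -/
def patch (l : List ℕ) (k : ℕ) (g : ℕ → ℕ) (n : ℕ) : ℕ := if n < k then l.getD n 0 else g n

theorem getD_initSeg (g : ℕ → ℕ) {k n : ℕ} (h : n < k) : (initSeg g k).getD n 0 = g n := by
  simp [initSeg, h]

theorem patch_initSeg_patch (l : List ℕ) (k : ℕ) (g : ℕ → ℕ) :
    patch (initSeg g k) k (patch l k g) = g := by
  funext n
  unfold patch
  split
  · exact getD_initSeg g ‹_›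
  · rfl

theorem isTuringFunctional_patch {l : (ℕ → ℕ) → List ℕ} {k : (ℕ → ℕ) → ℕ} {g : (ℕ → ℕ) → ℕ → ℕ}
    (hl : IsTuringFunctional fun f _ => Part.some (encode (l f)))
    (hk : IsTuringFunctional fun f _ => Part.some (k f))
    (hg : IsTuringFunctional fun f n => Part.some (g f n)) :
    IsTuringFunctional fun f n => Part.some (patch (l f) (k f) (g f) n) := by
  have hid : IsTuringFunctional fun _ n => Part.some n := .of_partrec Nat.Partrec.some
  have hget : Primrec fun z : ℕ =>
      ((decode (α := List ℕ) z.unpair.1).getD []).getD z.unpair.2 0 :=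
    (Primrec.list_getD 0).comp (Primrec.option_getD.comp (Primrec.decode.comp
      (Primrec.fst.comp Primrec.unpair)) (Primrec.const []))
      (Primrec.snd.comp Primrec.unpair)
  have hsub : Primrec fun z : ℕ => (z.unpair.2 + 1) - z.unpair.1 :=
    Primrec.nat_sub.comp (Primrec.succ.comp (Primrec.snd.comp Primrec.unpair))
      (Primrec.fst.comp Primrec.unpair)
  -- `ite` branches on a value being zero, and `(n + 1) - k` vanishes exactly when `n < k`.
  have hc : IsTuringFunctional fun f n => Part.some ((n + 1) - k f) :=
    ((isTuringFunctional_const hsub).comp (hk.pair hid)).of_eq fun f n => by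
      simp only [Part.map_some, Part.bind_some, Nat.unpair_pair]
  refine (((isTuringFunctional_const hget).comp (hl.pair hid)).ite hg hc).of_eq fun f n => ?_
  simp only [Part.map_some, Part.bind_some, Nat.unpair_pair, some_ite, encodek,
    Option.getD_some, patch, Nat.sub_eq_zero_iff_le, Nat.succ_le_iff]

/-- The original `g` is computable from its patched version by writing back its first `k` values, a
fixed finite list. -/
theorem TuringUpClosed.patch_mem {U : Set (ℕ → ℕ)} (hU : TuringUpClosed U) (l : List ℕ) (k : ℕ)
    {g : ℕ → ℕ} (hg : g ∈ U) : patch l k g ∈ U := by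
  refine hU g hg _ ?_
  have := turingLE_of_total (isTuringFunctional_patch (l := fun _ => initSeg g k) (k := fun _ => k)
    (g := fun f => f) (isTuringFunctional_const (Primrec.const _))
    (isTuringFunctional_const (Primrec.const _)) .oracle) (patch l k g)
  rwa [patch_initSeg_patch] at this

theorem initSeg_congr {f g : ℕ → ℕ} {k : ℕ} (h : ∀ n < k, f n = g n) :
    initSeg f k = initSeg g k :=
  List.map_congr_left fun n hn => h n (List.mem_range.1 hn)

/-- The first `k` values of `join g h`, computed from `k` values of `g` and of `h`. -/
def weave (l m : List ℕ) (k : ℕ) : List ℕ :=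
  initSeg (join (fun i => l.getD i 0) (fun i => m.getD i 0)) k

/-- Position `n < k` of a join reads index `n / 2 < k` of a component. The left side is free of `g`:
one halting computation on it serves every `g` patched by `l`. -/
theorem weave_eq (l : List ℕ) (k : ℕ) (g c : ℕ → ℕ) :
    weave l (initSeg c k) k = initSeg (join (patch l k g) c) k := by
  refine initSeg_congr fun n hn => ?_
  have : n / 2 < k := by omega
  unfold join patch
  split
  · rfl
  · exact getD_initSeg c this

theorem primrec_weave : Primrec fun x : (List ℕ × List ℕ) × ℕ => weave x.1.1 x.1.2 x.2 := by
  refine Primrec.list_map (Primrec.list_range.comp Primrec.snd) ?_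
  have hn : Primrec fun y : ((List ℕ × List ℕ) × ℕ) × ℕ => y.2 / 2 :=
    primrec_div_two.comp Primrec.snd
  have hx : Primrec fun y : ((List ℕ × List ℕ) × ℕ) × ℕ => y.1.1 :=
    Primrec.fst.comp Primrec.fst
  exact Primrec.ite (Primrec.eq.comp (primrec_mod_two.comp Primrec.snd) (Primrec.const 0))
    ((Primrec.list_getD 0).comp (Primrec.fst.comp hx) hn)
    ((Primrec.list_getD 0).comp (Primrec.snd.comp hx) hn)

/-- Prepending the first value of a partial functional. -/
theorem IsTuringFunctional.cons {P : (ℕ → ℕ) → ℕ →. ℕ} (hP : IsTuringFunctional P) :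
    IsTuringFunctional fun c n => if n = 0 then P c n else Part.some (c (n - 1)) :=
  hP.ite (isTuringFunctional_query primrec_sub_one) (isTuringFunctional_const Primrec.id)

theorem isTuringFunctional_cons_total {v : (ℕ → ℕ) → ℕ} {g : (ℕ → ℕ) → ℕ → ℕ}
    (hv : IsTuringFunctional fun f _ => Part.some (v f))
    (hg : IsTuringFunctional fun f n => Part.some (g f n)) :
    IsTuringFunctional fun f n => Part.some (Medvedev.cons (v f) (g f) n) := by
  refine (hv.ite (hg.comp (isTuringFunctional_const primrec_sub_one))
    (isTuringFunctional_const Primrec.id)).of_eq fun f n => ?_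
  simp only [Part.bind_some, some_ite, Medvedev.cons, id]

/-! ### Implication from an upwards closed problem distributes over meets. -/

/-- One step of the search for a prefix of `g`, together with a computation that halts on
`join g c`. -/
def searchStage (p : Code) (c : ℕ → ℕ) (z : ℕ) : Option ℕ :=
  Code.evaln z.unpair.2.unpair.2 p (Nat.pair (encode (weave
    ((decode (α := List ℕ) z.unpair.1).getD []) (initSeg c z.unpair.2.unpair.1)
    z.unpair.2.unpair.1)) 0)

theorem isTuringFunctional_searchStage (p : Code) :
    IsTuringFunctional fun c z => Part.some (encode (searchStage p c z)) := by
  have hid : IsTuringFunctional fun _ n => Part.some n := .of_partrec Nat.Partrec.some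
  have hk : Primrec fun z : ℕ => z.unpair.2.unpair.1 :=
    Primrec.fst.comp (Primrec.unpair.comp (Primrec.snd.comp Primrec.unpair))
  have hst : Primrec fun w : ℕ => encode (Code.evaln w.unpair.1.unpair.2.unpair.2 p
      (Nat.pair (encode (weave
        ((decode (α := List ℕ) w.unpair.1.unpair.1).getD [])
        ((decode (α := List ℕ) w.unpair.2).getD [])
        w.unpair.1.unpair.2.unpair.1)) 0)) := by
    have hl := Primrec.fst.comp Primrec.unpair
    have hr := Primrec.snd.comp Primrec.unpair
    have hd : Primrec fun n : ℕ => (decode (α := List ℕ) n).getD [] :=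
      Primrec.option_getD.comp Primrec.decode (Primrec.const [])
    refine Primrec.encode.comp ?_
    exact Code.primrec_evaln.comp (Primrec.pair (Primrec.pair (hr.comp (hr.comp hl))
      (Primrec.const p)) (Primrec₂.natPair.comp (Primrec.encode.comp (primrec_weave.comp
        (Primrec.pair (Primrec.pair (hd.comp (hl.comp hl)) (hd.comp hr)) (hk.comp hl))))
        (Primrec.const 0)))
  refine ((isTuringFunctional_const hst).comp (hid.pair
    (isTuringFunctional_initSeg.comp (isTuringFunctional_const hk)))).of_eq fun c z => ?_
  simp only [Part.map_some, Part.bind_some, Nat.unpair_pair, encodek, Option.getD_some, searchStage]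

/-- The search for a halting stage is effective in `c`; its result `z` is stored in front of `c` so
that later functionals can read it off. -/
theorem reduces_cons_searchStage (p : Code) {C : Set (ℕ → ℕ)}
    (h : ∀ c ∈ C, ∃ z, (searchStage p c z).isSome) :
    Reduces {w | ∃ c ∈ C, ∃ z, (searchStage p c z).isSome ∧ w = cons z c} C := by
  have hS := isTuringFunctional_searchStage p
  -- `encode` is `0` only on `none`, so `1 - encode o` is zero, as `rfind` requires, exactly when
  -- the stage halts.
  have hR := IsTuringFunctional.rfind ((isTuringFunctional_const (k := fun n => 1 - n)
    (Primrec.nat_sub.comp (Primrec.const 1) Primrec.id)).comp (hS.comp .right))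
  refine ⟨_, hR.cons, fun c hc => ?_⟩
  have hbool : ∀ o : Option ℕ, decide (1 - encode o = 0) = o.isSome := by
    rintro (_ | a) <;> simp
  simp only [Part.map_some, Part.bind_some, Nat.unpair_pair, hbool]
  have hd : (Nat.rfind fun n => Part.some (searchStage p c n).isSome).Dom := by
    obtain ⟨z, hz⟩ := h c hc
    exact Nat.rfind_dom.2 ⟨z, by simpa using hz, fun _ => trivial⟩
  have hspec := Nat.rfind_spec (Part.get_mem hd)
  simp only [Part.mem_some_iff] at hspec
  refine ⟨_, ⟨c, hc, _, hspec.symm, rfl⟩, fun n => ?_⟩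
  unfold cons
  split
  · exact (Part.some_get hd).symm
  · rfl

/-- From `c`, find a finite prefix `l` on which the given functional already outputs its first value
`v`. Every `g ∈ U` patched by `l` stays in `U` and yields the same `v`, so `v` selects a factor
uniformly in `g`. Nonemptiness of `U` makes the search halt. -/
theorem prod_imp_reduces {U B₁ B₂ C : Set (ℕ → ℕ)} (hU : TuringUpClosed U) (hne : U.Nonempty)
    (h : Reduces (prod B₁ B₂) (sum U C)) : Reduces (prod (imp U B₁) (imp U B₂)) C := by
  obtain ⟨F, hF, h⟩ := h
  obtain ⟨p, p1, -, p3⟩ := hF.exists_use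
  obtain ⟨cd, hcd⟩ := Code.exists_code.1 p1
  have hcd' : ∀ σ n m, m ∈ cd.eval (Nat.pair (encode σ) n) ↔ m ∈ p (σ, n) := by
    intro σ n m
    rw [hcd, show Nat.pair (encode σ) n = encode (σ, n) from rfl]
    simp
  obtain ⟨g₀, hg₀⟩ := hne
  refine Reduces.trans ?_ (reduces_cons_searchStage cd fun c hc => ?_)
  · have hz := isTuringFunctional_query (Primrec.const 0)
    -- The subtraction undoes `encode (some v) = v + 1`.
    have hv : IsTuringFunctional fun w _ => Part.some
        (encode (searchStage cd (fun n => w (n + 1)) (w 0)) - 1) := by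
      obtain ⟨H, hH, e⟩ := (isTuringFunctional_searchStage cd).subst
        (isTuringFunctional_query Primrec.succ)
      refine ((isTuringFunctional_const primrec_sub_one).comp (hH.comp hz)).of_eq fun w n => ?_
      simp only [Part.bind_some, e w (fun n => w (n + 1)) fun _ => rfl]
    have hz0 : Primrec fun _ : ℕ => 2 * 0 := Primrec.const _
    have hq : Primrec fun n : ℕ => 2 * (n + 1) := primrec_even.comp Primrec.succ
    -- The oracle `w` has the form `join (cons z c) g`: `z` sits at `0`, `c` at the later even
    -- places, `g` at the odd ones.
    have hJ : IsTuringFunctional fun w n => Part.some (join (patch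
        ((decode (α := List ℕ) (w (2 * 0)).unpair.1).getD []) (w (2 * 0)).unpair.2.unpair.1
          (fun n => w (2 * n + 1))) (fun n => w (2 * (n + 1))) n) := by
      have hl : Primrec fun z : ℕ => encode ((decode (α := List ℕ) z.unpair.1).getD []) :=
        Primrec.encode.comp (Primrec.option_getD.comp (Primrec.decode.comp
          (Primrec.fst.comp Primrec.unpair)) (Primrec.const []))
      have hk : Primrec fun z : ℕ => z.unpair.2.unpair.1 :=
        Primrec.fst.comp (Primrec.unpair.comp (Primrec.snd.comp Primrec.unpair))
      refine isTuringFunctional_join (isTuringFunctional_patch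
        (((isTuringFunctional_const hl).comp (isTuringFunctional_query hz0)).of_eq ?_)
        (((isTuringFunctional_const hk).comp (isTuringFunctional_query hz0)).of_eq ?_)
        (isTuringFunctional_query primrec_odd)) (isTuringFunctional_query hq)
      all_goals intro f n; simp only [Part.bind_some]
    obtain ⟨G, hG, e⟩ := hF.subst hJ
    -- The successor drops the leading value, which only names the factor.
    obtain ⟨i, hi⟩ := (hG.comp (isTuringFunctional_const Primrec.succ)).exists_index
    refine .of_total (isTuringFunctional_cons_total hv (isTuringFunctional_cons i)) ?_
    rintro _ ⟨c, hc, z, hs, rfl⟩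
    obtain ⟨v, hv⟩ := Option.isSome_iff_exists.1 hs
    set l := (decode (α := List ℕ) z.unpair.1).getD [] with hl
    set k := z.unpair.2.unpair.1 with hk
    have hFv : ∀ g, F (join (patch l k g) c) 0 = Part.some v := by
      intro g
      refine Part.eq_some_iff.2 ((p3 _ _ _).2 ⟨k, ?_⟩)
      rw [← hcd', ← weave_eq l k g c]
      exact Code.evaln_sound (hv : v ∈ searchStage cd c z)
    have hphi : ∀ g n, phi i (join (cons z c) g) n = F (join (patch l k g) c) (n + 1) := by
      intro g n
      rw [hi, Part.bind_some, e _ (join (patch l k g) c) fun n => by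
        simp only [join_odd, join_even, cons_zero, cons_succ, ← hl, ← hk]]
    have hval : ∀ g ∈ U, (v = 0 ∧ ∃ b ∈ B₁, ∀ n, phi i (join (cons z c) g) n = Part.some (b n)) ∨
        (v = 1 ∧ ∃ b ∈ B₂, ∀ n, phi i (join (cons z c) g) n = Part.some (b n)) := by
      intro g hg
      obtain ⟨b, hb, hb'⟩ := h _ ⟨_, hU.patch_mem l k hg, c, hc, rfl⟩
      have h0 := Part.some_inj.1 ((hFv g).symm.trans (hb' 0))
      rcases hb with ⟨b, hb, rfl⟩ | ⟨b, hb, rfl⟩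
      · exact .inl ⟨h0, b, hb, fun n => by rw [hphi, hb', cons_succ]⟩
      · exact .inr ⟨h0, b, hb, fun n => by rw [hphi, hb', cons_succ]⟩
    simp only [cons_zero, cons_succ, hv, encode_some, encode_nat, Nat.succ_sub_one]
    rcases hval g₀ hg₀ with ⟨rfl, -⟩ | ⟨rfl, -⟩
    · refine .inl ⟨_, ⟨i, cons z c, rfl, fun g hg => ?_⟩, rfl⟩
      exact ((hval g hg).resolve_right fun h => absurd h.1 (by simp)).2
    · refine .inr ⟨_, ⟨i, cons z c, rfl, fun g hg => ?_⟩, rfl⟩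
      exact ((hval g hg).resolve_left fun h => absurd h.1 (by simp)).2
  · obtain ⟨b, -, hb⟩ := h _ ⟨g₀, hg₀, c, hc, rfl⟩
    obtain ⟨k, hk⟩ := (p3 _ _ _).1 (Part.eq_some_iff.1 (hb 0))
    obtain ⟨s, hs⟩ := Code.evaln_complete.1 ((hcd' _ _ _).2 hk)
    -- The use `k` and step bound `s` of the computation on `join g₀ c` give a halting stage, as
    -- patching `g₀` by its own prefix changes nothing.
    refine ⟨Nat.pair (encode (initSeg g₀ k)) (Nat.pair k s), Option.isSome_iff_exists.2 ⟨b 0, ?_⟩⟩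
    simp only [searchStage, Nat.unpair_pair, encodek, Option.getD_some]
    rw [weave_eq _ _ g₀]
    have : patch (initSeg g₀ k) k g₀ = g₀ := by
      funext n
      unfold patch
      split
      · exact getD_initSeg g₀ ‹_›
      · rfl
    rwa [this]

theorem inf_deg_sdiff {U : Set (ℕ → ℕ)} (hU : TuringUpClosed U) (b₁ b₂ : MedvedevDegree) :
    (b₁ ⊓ b₂) \ deg U = (b₁ \ deg U) ⊓ (b₂ \ deg U) := by
  refine le_antisymm (le_inf (sdiff_le_sdiff_right inf_le_left)
    (sdiff_le_sdiff_right inf_le_right)) ?_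
  -- For empty `U` the antecedent is the top and both sides are the bottom.
  rcases U.eq_empty_or_nonempty with rfl | hne
  · have htop : deg ∅ = (⊤ : MedvedevDegree) := rfl
    simp [htop]
  · obtain ⟨B₁, rfl⟩ := deg_surjective b₁
    obtain ⟨B₂, rfl⟩ := deg_surjective b₂
    refine prod_imp_reduces hU hne ?_
    exact reduces_sum_imp U (prod B₁ B₂)

/-- The image of the zero function is computable, so one factor has a computable element, and the
functional `G` ignoring its oracle outputs it. -/
theorem reduces_univ_of_prod {B₁ B₂ : Set (ℕ → ℕ)} (h : Reduces (prod B₁ B₂) Set.univ) :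
    Reduces B₁ Set.univ ∨ Reduces B₂ Set.univ := by
  obtain ⟨F, hF, h⟩ := h
  obtain ⟨b, hb, e⟩ := h (fun _ => 0) trivial
  obtain ⟨G, hG, e'⟩ := (hF.comp (isTuringFunctional_const Primrec.succ)).subst
    (isTuringFunctional_const (Primrec.const 0))
  have key : ∀ (g : ℕ → ℕ) n, G g n = Part.some (b (n + 1)) := fun g n => by
    refine (congrFun (e' g (fun _ => 0) fun _ => rfl) n).trans ?_
    simp only [Part.bind_some, e]
  rcases hb with ⟨b, hb, rfl⟩ | ⟨b, hb, rfl⟩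
  · exact .inl ⟨G, hG, fun g _ => ⟨b, hb, key g⟩⟩
  · exact .inr ⟨G, hG, fun g _ => ⟨b, hb, key g⟩⟩

theorem inf_le_bot_iff {b₁ b₂ : MedvedevDegree} : b₁ ⊓ b₂ ≤ ⊥ ↔ b₁ ≤ ⊥ ∨ b₂ ≤ ⊥ := by
  refine ⟨?_, fun h => h.elim inf_le_left.trans inf_le_right.trans⟩
  obtain ⟨B₁, rfl⟩ := deg_surjective b₁
  obtain ⟨B₂, rfl⟩ := deg_surjective b₂
  exact reduces_univ_of_prod

/-- Distributivity moves the question from `deg U` down to `⊥`, which is meet-prime. -/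
theorem TuringUpClosed.inf_le_deg_iff {U : Set (ℕ → ℕ)} (hU : TuringUpClosed U)
    {b₁ b₂ : MedvedevDegree} : b₁ ⊓ b₂ ≤ deg U ↔ b₁ ≤ deg U ∨ b₂ ≤ deg U := by
  have key : ∀ b : MedvedevDegree, b ≤ deg U ↔ b \ deg U ≤ ⊥ := fun b => by
    rw [sdiff_le_iff, sup_bot_eq]
  rw [key, key b₁, key b₂, inf_deg_sdiff hU, inf_le_bot_iff]

/-! ### The elements `α(X)` of the interval. -/

theorem IsStrongUpAntichain.eq_of_turingLE {I : Type*} {A : Set (ℕ → ℕ)} {f : I → ℕ → ℕ}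
    (hf : IsStrongUpAntichain A f) (hA : TuringDownClosed A) {i j : I} {g : ℕ → ℕ} (hg : g ∈ A)
    (hi : TuringLE (f i) g) (hj : TuringLE (f j) g) : i = j := by
  by_contra h
  exact hf.2 i j h (hA g hg _ (hi.join hj))

section Alpha

variable {I : Type*} {A : Set (ℕ → ℕ)} {f : I → ℕ → ℕ}

theorem mem_alphaProblem {X : Set I} {g : ℕ → ℕ} :
    g ∈ alphaProblem A f X ↔ (g ∈ A → ∃ i ∈ X, TuringLE (f i) g) := by
  simp only [alphaProblem, upperCone, Set.mem_union, Set.mem_compl_iff, Set.mem_ofPred_eq,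
    Set.exists_mem_image]
  tauto

theorem turingUpClosed_alphaProblem (hA : TuringDownClosed A) (X : Set I) :
    TuringUpClosed (alphaProblem A f X) := by
  intro g hg h hgh
  rw [mem_alphaProblem] at hg ⊢
  intro hh
  obtain ⟨i, hi, hig⟩ := hg (hA h hh g hgh)
  exact ⟨i, hi, hig.trans hgh⟩

theorem alpha_anti {X Y : Set I} (h : X ⊆ Y) : alpha A f Y ≤ alpha A f X :=
  deg_alphaProblem_anti A f h

theorem alpha_empty : alpha A f ∅ = ⊤ :=
  top_le_iff.1 ((⊤ : AlphaInterval A f).2.2)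

theorem alpha_univ : alpha A f Set.univ = ⊥ :=
  le_bot_iff.1 ((⊥ : AlphaInterval A f).2.1)

/-- The points `f i` are tests: each lies in `A` and computes no other `f j`, so it belongs to the
problem for `X` only when `i ∈ X`. -/
theorem alpha_le_alpha_iff (hA : TuringDownClosed A) (hf : IsStrongUpAntichain A f)
    {X Y : Set I} : alpha A f X ≤ alpha A f Y ↔ Y ⊆ X := by
  refine ⟨fun h i hi => ?_, alpha_anti⟩
  have hsub := (turingUpClosed_alphaProblem hA X).reduces_iff.1 (deg_le_deg.1 h)
  have hmem : f i ∈ alphaProblem A f Y := mem_alphaProblem.2 fun _ => ⟨i, hi, .refl _⟩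
  obtain ⟨j, hj, hji⟩ := mem_alphaProblem.1 (hsub hmem) (hf.1 i)
  rwa [hf.eq_of_turingLE hA (hf.1 i) (.refl _) hji]

/-- If `g ⊕ h` is in `A`, the indices witnessing `g` and `h` must agree, since both functions lie
below `g ⊕ h`. -/
theorem alpha_sup_alpha (hA : TuringDownClosed A) (hf : IsStrongUpAntichain A f) (X Y : Set I) :
    alpha A f X ⊔ alpha A f Y = alpha A f (X ∩ Y) := by
  refine le_antisymm (sup_le (alpha_anti Set.inter_subset_left) (alpha_anti Set.inter_subset_right))
    ?_
  refine Reduces.of_subset (A := alphaProblem A f (X ∩ Y))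
    (B := sum (alphaProblem A f X) (alphaProblem A f Y)) ?_
  rintro _ ⟨g, hg, h, hh, rfl⟩
  refine mem_alphaProblem.2 fun hgh => ?_
  obtain ⟨i, hi, hig⟩ := mem_alphaProblem.1 hg (hA _ hgh _ (turingLE_join_left g h))
  obtain ⟨j, hj, hjh⟩ := mem_alphaProblem.1 hh (hA _ hgh _ (turingLE_join_right g h))
  have hi' := hig.trans (turingLE_join_left g h)
  obtain rfl := hf.eq_of_turingLE hA hgh hi' (hjh.trans (turingLE_join_right g h))
  exact ⟨i, ⟨hi, hj⟩, hi'⟩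

theorem alpha_sdiff_alpha (hA : TuringDownClosed A) (hf : IsStrongUpAntichain A f) (X Y : Set I) :
    alpha A f Y \ alpha A f X = alpha A f (Y ∪ Xᶜ) := by
  refine le_antisymm (sdiff_le_iff.2 ?_) ?_
  · rw [alpha_sup_alpha hA hf]
    exact alpha_anti fun i hi => hi.2.resolve_right (not_not_intro hi.1)
  · have key : ∀ c : AlphaInterval A f, alpha A f Y ≤ alpha A f X ⊔ c →
        alpha A f (Y ∪ Xᶜ) ≤ c := by
      rintro ⟨c, hc⟩ h
      obtain ⟨C, rfl⟩ := deg_surjective c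
      refine Reduces.of_subset (A := alphaProblem A f (Y ∪ Xᶜ)) (B := C) fun g hg => ?_
      have hI := (turingUpClosed_alphaProblem hA _).reduces_iff.1 (deg_le_deg.1 hc.1)
      have hY : sum (alphaProblem A f X) C ⊆ alphaProblem A f Y :=
        (turingUpClosed_alphaProblem hA _).reduces_iff.1 h
      refine mem_alphaProblem.2 fun hgA => ?_
      -- This is where the lower end `α(I)` of the interval enters: an element of `C` in `A`
      -- computes some `f i`.
      obtain ⟨i, -, hi⟩ := mem_alphaProblem.1 (hI hg) hgA
      by_cases hiX : i ∈ X
      · have hgX : g ∈ alphaProblem A f X := mem_alphaProblem.2 fun _ => ⟨i, hiX, hi⟩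
        -- With `i ∈ X`, the same `g` serves as both halves of the join; `g ⊕ g` stays in `A` and
        -- computes nothing beyond `g`.
        have hgg := (TuringLE.refl g).join (.refl g)
        obtain ⟨j, hj, hjg⟩ := mem_alphaProblem.1 (hY ⟨g, hgX, g, hg, rfl⟩) (hA g hgA _ hgg)
        exact ⟨j, .inl hj, hjg.trans hgg⟩
      · exact ⟨i, .inr hiX, hi⟩
    exact key _ (sdiff_le_iff.1 le_rfl)

theorem inf_sdiff_alpha (hA : TuringDownClosed A) (b₁ b₂ : AlphaInterval A f) (X : Set I) :
    (b₁ ⊓ b₂) \ alpha A f X = (b₁ \ alpha A f X) ⊓ (b₂ \ alpha A f X) := by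
  refine Subtype.ext ?_
  change (b₁.1 ⊓ b₂.1) \ deg (alphaProblem A f X) ⊔ _ =
    (b₁.1 \ deg (alphaProblem A f X) ⊔ _) ⊓ (b₂.1 \ deg (alphaProblem A f X) ⊔ _)
  rw [inf_deg_sdiff (turingUpClosed_alphaProblem hA X), sup_inf_right]

theorem inf_le_alpha_iff (hA : TuringDownClosed A) {b₁ b₂ : AlphaInterval A f} {X : Set I} :
    b₁ ⊓ b₂ ≤ alpha A f X ↔ b₁ ≤ alpha A f X ∨ b₂ ≤ alpha A f X :=
  (turingUpClosed_alphaProblem hA X).inf_le_deg_iff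

/-! ### Finite meets of the `α(X)` as a sub-Brouwer algebra. -/

/-- Meet-primality of `α(Y)`. For `Y = ∅` and `S = ∅` it would fail, the empty meet being `α(∅)`. -/
theorem finsetInf_alpha_le_alpha_iff (hA : TuringDownClosed A) (hf : IsStrongUpAntichain A f)
    {S : Finset (Set I)} {Y : Set I} (hY : Y.Nonempty) :
    S.inf (alpha A f) ≤ alpha A f Y ↔ ∃ X ∈ S, Y ⊆ X := by
  classical
  induction S using Finset.induction with
  | empty =>
    rw [Finset.inf_empty, ← alpha_empty, alpha_le_alpha_iff hA hf]
    simp [hY.ne_empty]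
  | insert X S _ ih =>
    rw [Finset.inf_insert, inf_le_alpha_iff hA, ih, alpha_le_alpha_iff hA hf]
    simp

theorem range_finsetInf_alpha :
    Set.range (fun S : Finset (Set I) => S.inf (alpha A f)) =
      {z | ∃ m : ℕ, 1 ≤ m ∧ ∃ X : Fin m → Set I,
        z = Finset.univ.inf fun i => alpha A f (X i)} := by
  classical
  ext z
  constructor
  · rintro ⟨S, rfl⟩
    -- The extra entry `∅` contributes the top, so it secures `m ≥ 1` without changing the meet.
    refine ⟨_, S.card.succ_pos, Fin.cons ∅ fun i => (S.equivFin.symm i).1, ?_⟩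
    rw [Fin.univ_succ, Finset.inf_cons, Finset.inf_map]
    simp only [Fin.cons_zero, alpha_empty, top_inf_eq]
    refine le_antisymm (Finset.le_inf fun i _ => Finset.inf_le (S.equivFin.symm i).2)
      (Finset.le_inf fun X hX => ?_)
    refine (Finset.inf_le (Finset.mem_univ (S.equivFin ⟨X, hX⟩))).trans ?_
    simp
  · rintro ⟨m, -, X, rfl⟩
    exact ⟨Finset.univ.image X, Finset.inf_image _ _ _⟩

/-- The sub-Brouwer algebra of the meets of elements `α(X)`. -/
def alphaSubalgebra (hA : TuringDownClosed A) (hf : IsStrongUpAntichain A f) :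
    SubBrouwerAlgebra (AlphaInterval A f) :=
  have hsup : ∀ S T : Finset (Set I), S.inf (alpha A f) ⊔ T.inf (alpha A f) ∈
      Set.range fun S : Finset (Set I) => S.inf (alpha A f) := fun S T => by
    classical
    refine ⟨(S ×ˢ T).image fun x => x.1 ∩ x.2, ?_⟩
    simp only [Finset.inf_image, Finset.inf_sup_inf, alpha_sup_alpha hA hf]
    rfl
  have hinf : ∀ S T : Finset (Set I), S.inf (alpha A f) ⊓ T.inf (alpha A f) ∈
      Set.range fun S : Finset (Set I) => S.inf (alpha A f) := fun S T => by
    classical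
    exact ⟨S ∪ T, Finset.inf_union⟩
  have hα : ∀ X, alpha A f X ∈ Set.range fun S : Finset (Set I) => S.inf (alpha A f) :=
    fun X => ⟨{X}, Finset.inf_singleton⟩
  { carrier := Set.range fun S : Finset (Set I) => S.inf (alpha A f)
    sup_mem := by
      rintro _ ⟨S, rfl⟩ _ ⟨T, rfl⟩
      exact hsup S T
    inf_mem := by
      rintro _ ⟨S, rfl⟩ _ ⟨T, rfl⟩
      exact hinf S T
    sdiff_mem := by
      classical
      rintro _ ⟨S, rfl⟩ _ ⟨T, rfl⟩
      -- With a single `α(X)` as antecedent, the meet in the consequent is pulled out factor by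
      -- factor.
      have h1 : ∀ X, T.inf (alpha A f) \ alpha A f X ∈
          Set.range fun S : Finset (Set I) => S.inf (alpha A f) := by
        intro X
        induction T using Finset.induction with
        | empty =>
          rw [Finset.inf_empty, ← alpha_empty, alpha_sdiff_alpha hA hf]
          exact hα _
        | insert Y T _ ih =>
          rw [Finset.inf_insert, inf_sdiff_alpha hA, alpha_sdiff_alpha hA hf,
            ← Finset.inf_singleton (f := alpha A f)]
          obtain ⟨U, hU⟩ := ih
          rw [← hU]
          exact hinf _ _
      simp only
      induction S using Finset.induction with
      | empty =>
        rw [Finset.inf_empty, sdiff_top, ← alpha_univ]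
        exact hα _
      | insert X S _ ih =>
        -- A meet in the antecedent turns into a join of implications.
        rw [Finset.inf_insert, sdiff_inf]
        obtain ⟨U, hU⟩ := h1 X
        obtain ⟨V, hV⟩ := ih
        rw [← hU, ← hV]
        exact hsup _ _
    bot_mem := alpha_univ (A := A) (f := f) ▸ hα _
    top_mem := alpha_empty (A := A) (f := f) ▸ hα _ }

/-! ### The isomorphism with `ℬₙ`. -/

/-- A meet of elements `α(X)` is determined by the nonempty sets `Y` such that `α(Y)` is
above it. -/
noncomputable def alphaSubalgebraEquiv [Finite I] {n : ℕ} (e : I ≃ Set.Icc 1 n) (hA : TuringDownClosed A)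
    (hf : IsStrongUpAntichain A f) : (alphaSubalgebra hA hf).carrier ≃o BrouwerB n :=
  let u (z : (alphaSubalgebra hA hf).carrier) : BrouwerB n :=
    { carrier := {Y | z.1 ≤ alpha A f (e ⁻¹' (OrderDual.ofDual Y).1)}
      upper' := fun _ _ h hz => le_trans hz (alpha_anti (Set.preimage_mono h)) }
  have hu : ∀ z w, u z ≤ u w ↔ z ≤ w := by
    rintro z ⟨_, S, rfl⟩
    refine ⟨fun h => show z.1 ≤ S.inf (alpha A f) from Finset.le_inf fun X hX => ?_,
      fun h _ hY => le_trans (α := AlphaInterval A f) h hY⟩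
    -- An empty `X` is invisible to `u` but contributes only the top; a nonempty one is itself a
    -- member of the family of the meet.
    rcases X.eq_empty_or_nonempty with rfl | hne
    · rw [alpha_empty]
      exact le_top
    · have hX' : e ⁻¹' (e '' X) = X := e.preimage_image X
      have hmem : OrderDual.toDual (⟨e '' X, hne.image e⟩ : {X : Set (Set.Icc 1 n) // X.Nonempty}) ∈
          u ⟨_, S, rfl⟩ := by
        change S.inf (alpha A f) ≤ alpha A f (e ⁻¹' (e '' X))
        rw [hX']
        exact Finset.inf_le hX
      have := h hmem
      change z.1 ≤ alpha A f (e ⁻¹' (e '' X)) at this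
      rwa [hX'] at this
  have hsurj : Function.Surjective u := fun U => by
    -- The meet over all members of `U`, finite since `I` is; by primality `α(Y)` is above it iff
    -- `Y` lies inside a member, hence iff `Y ∈ U`.
    let S : Set (Set I) := {X | ∃ Y ∈ U, X = e ⁻¹' (OrderDual.ofDual Y).1}
    refine ⟨⟨_, S.toFinite.toFinset, rfl⟩, UpperSet.ext (Set.ext fun Y => ?_)⟩
    refine (finsetInf_alpha_le_alpha_iff hA hf
      ((OrderDual.ofDual Y).2.preimage e.surjective)).trans ?_
    simp only [Set.Finite.mem_toFinset]
    constructor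
    · rintro ⟨_, ⟨Z, hZ, rfl⟩, h⟩
      exact U.upper ((e.surjective.preimage_subset_preimage_iff).1 h) hZ
    · exact fun hY => ⟨_, ⟨Y, hY, rfl⟩, subset_rfl⟩
  { Equiv.ofBijective u ⟨fun z w h => le_antisymm ((hu z w).1 h.le) ((hu w z).1 h.ge), hsurj⟩ with
    map_rel_iff' := hu _ _ }

end Alpha

end Medvedev

theorem mainTheorem6 {I : Type*} [Finite I] (n : ℕ) (hn : Nat.card I = n)
    (A : Set (ℕ → ℕ)) (hA : Medvedev.TuringDownClosed A)
    (f : I → ℕ → ℕ) (hf : Medvedev.IsStrongUpAntichain A f) :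
    ∃ L : Medvedev.SubBrouwerAlgebra (Medvedev.AlphaInterval A f),
      L.carrier = {z | ∃ m : ℕ, 1 ≤ m ∧ ∃ X : Fin m → Set I,
        z = Finset.univ.inf fun i => Medvedev.alpha A f (X i)} ∧
      ∃ φ : CoheytingHom L.carrier (Medvedev.BrouwerB n), Function.Bijective φ := by
  refine ⟨Medvedev.alphaSubalgebra hA hf, Medvedev.range_finsetInf_alpha, ?_⟩
  have e : I ≃ Set.Icc 1 n := (Finite.equivFinOfCardEq hn).trans
    (Finite.equivFinOfCardEq (by simp)).symm
  let ψ := Medvedev.alphaSubalgebraEquiv e hA hf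
  -- The order determines all Brouwer operations, so an order isomorphism preserves them.
  exact ⟨(ψ : CoheytingHom _ _), ψ.bijective⟩
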